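/- Let $A$ be a separable, unital $\mathrm{C}^*$-algebra, with self-adjoint part $A_{sa}$, positive cone $A_+$ and space of tracial states $T(A)$. Let $$A_0=\Big\{a-b \;\Big|\; a,b\in A_+,\ \exists (x_n)_{n}\subseteq A:\ a=\sum_n x_n^*x_n,\ b=\sum_n x_nx_n^*\Big\},$$ with norm-convergent series; this is a real subspace of $A_{sa}$. Let $q\colon A_{sa}\to A^q:=A_{sa}/A_0$ be the quotient map, and equip $A^q$ with the quotient norm. Let $L\colon A\to[0,\infty]$ be a seminorm (that is, $L(a+b)\le L(a)+L(b)$ and $L(\lambda a)=|\lambda|L(a)$ for $\lambda\in\mathbb{C}$, with $0\cdot\infty=0$), and suppose that $(A,L)$ is a $\mathrm{C}^*$-algebraic quantum metric Choquet simplex, which means that: 1. $A^q$ is tracially ordered, that is, $T(A)\neq\emptyset$ and $q(A_+)=\{q(a)\mid a\in A_{sa},\ \tau(a)\ge 0 \text{ for every } \tau\in T(A)\}$; 2. $L(a^*)=L(a)$ for every $a\in A$, $L$ is lower semicontinuous, and $\{a\in A\mid L(a)<\infty\}$ is dense in $A$; 3. $\{a\in A\mid L(a)=0\}=\operatorname{span}_{\mathbb{C}}(\{1\}\cup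 A_0)$; 4. the topology on $T(A)$ induced by $\rho_L(\sigma,\tau)=\sup\{|\sigma(a)-\tau(a)| \mid a\in A,\ L(a)\le1\}$ is the $w^*$-topology. By 3, $L$ induces a seminorm on $A^q$, also denoted $L$, with $L(q(a))=L(a)$ for $a\in A_{sa}$. Let $r_{(A,L)}=\frac12\sup\{\rho_L(\sigma,\tau)\mid\sigma,\tau\in T(A)\}$ be the radius of $(A,L)$. Then, for every real $r\ge r_{(A,L)}$, there exists a (norm) compact set $\mathcal{D}_r(A)\subseteq A_{sa}$ (called a nucleus of $(A,L)$) such that $$q(\mathcal{D}_r(A))=\{x\in A^q\mid L(x)\le1,\ \|x\|\le r\}$$ and $$\mathcal{D}_r(A)+\mathbb{R}1+A_0=\{a\in A_{sa}\mid L(a)\le1\}.$$ -/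

import Mathlib

open scoped ENNReal NNReal Topology ComplexOrder Pointwise

namespace CStarQMCS

section

variable {A : Type*} [CStarAlgebra A]

/-- Cuntz--Pedersen equivalence: `a = ∑ xₙ* xₙ` and `b = ∑ xₙ xₙ*` for a sequence `xₙ` in `A`
(norm convergent series; for series of positive elements convergence is unconditional). -/
def CPEquiv (a b : A) : Prop :=
  ∃ x : ℕ → A, HasSum (fun n => star (x n) * x n) a ∧ HasSum (fun n => x n * star (x n)) b

theorem CPEquiv.symm {a b : A} (h : CPEquiv a b) : CPEquiv b a := by
  obtain ⟨x, h1, h2⟩ := h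
  exact ⟨fun n => star (x n), by simpa using h2, by simpa using h1⟩

theorem CPEquiv.add {a b a' b' : A} (h : CPEquiv a b) (h' : CPEquiv a' b') :
    CPEquiv (a + a') (b + b') := by
  obtain ⟨x, h1, h2⟩ := h
  obtain ⟨y, h3, h4⟩ := h'
  let z : ℕ → A := fun n => if Even n then x (n / 2) else y (n / 2)
  have ze : ∀ k, z (2 * k) = x k := fun k => by simp [z]
  have zo : ∀ k, z (2 * k + 1) = y k := fun k => by
    have : (2 * k + 1) / 2 = k := by omega
    simp [z, this]
  refine ⟨z, HasSum.even_add_odd ?_ ?_, HasSum.even_add_odd ?_ ?_⟩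
  · simpa only [ze] using h1
  · simpa only [zo] using h3
  · simpa only [ze] using h2
  · simpa only [zo] using h4

theorem CPEquiv.smul_sq {a b : A} (h : CPEquiv a b) (t : ℝ) :
    CPEquiv ((t * t) • a) ((t * t) • b) := by
  obtain ⟨x, h1, h2⟩ := h
  refine ⟨fun n => t • x n, ?_, ?_⟩
  · simpa [smul_smul] using h1.const_smul (t * t)
  · simpa [smul_smul] using h2.const_smul (t * t)

variable (A) [PartialOrder A] [StarOrderedRing A]

/-- The set `T(A)` of tracial states of `A`, inside the dual of `A` with its w*-topology. -/
def tracialStates : Set (WeakDual ℂ A) :=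
  {τ | (∀ a : A, 0 ≤ a → 0 ≤ τ a) ∧ τ 1 = 1 ∧ ∀ a b : A, τ (a * b) = τ (b * a)}

/-- The trace space `T(A)`; as a subtype it carries the w*-topology. -/
abbrev TraceSpace : Type _ := tracialStates A

/-- The subspace `A₀ = {a - b | a, b ∈ A₊, a ∼ b}` of the real vector space `A_sa`. -/
def cpNull : Submodule ℝ (selfAdjoint A) where
  carrier := {c | ∃ a b : A, 0 ≤ a ∧ 0 ≤ b ∧ CPEquiv a b ∧ (c : A) = a - b}
  zero_mem' := ⟨0, 0, le_rfl, le_rfl, ⟨fun _ => 0, by simp, by simp⟩, by simp⟩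
  add_mem' := by
    rintro c d ⟨a, b, ha, hb, h, hc⟩ ⟨a', b', ha', hb', h', hd⟩
    refine ⟨a + a', b + b', add_nonneg ha ha', add_nonneg hb hb', h.add h', ?_⟩
    rw [AddSubgroup.coe_add, hc, hd]
    abel
  smul_mem' := by
    rintro t c ⟨a, b, ha, hb, h, hc⟩
    rcases le_total 0 t with ht | ht
    · refine ⟨t • a, t • b, smul_nonneg ht ha, smul_nonneg ht hb, ?_, ?_⟩
      · have := h.smul_sq (Real.sqrt t)
        rwa [Real.mul_self_sqrt ht] at this
      · rw [selfAdjoint.val_smul, hc, smul_sub]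
    · have ht' : 0 ≤ -t := by linarith
      refine ⟨(-t) • b, (-t) • a, smul_nonneg ht' hb, smul_nonneg ht' ha, ?_, ?_⟩
      · have := h.symm.smul_sq (Real.sqrt (-t))
        rwa [Real.mul_self_sqrt ht'] at this
      · rw [selfAdjoint.val_smul, hc, smul_sub, neg_smul, neg_smul]
        abel

/-- The Cuntz--Pedersen quotient `A^q = A_sa / A₀`, with the quotient norm. -/
abbrev CPQuotient : Type _ := selfAdjoint A ⧸ cpNull A

/-- The quotient map `q : A_sa → A^q`. -/
noncomputable abbrev quot : selfAdjoint A →ₗ[ℝ] CPQuotient A := (cpNull A).mkQ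

/-- The positive cone `q(A₊)` of `A^q`. -/
def posCone : Set (CPQuotient A) := quot A '' {a | 0 ≤ (a : A)}

/-- `A^q` is tracially ordered: `T(A)` is nonempty, and the positive cone of `A^q` consists of
the classes of those self-adjoint `a` with `τ(a) ≥ 0` for every tracial state `τ`. -/
def TraciallyOrdered : Prop :=
  (tracialStates A).Nonempty ∧
    posCone A = quot A '' {a | ∀ τ ∈ tracialStates A, 0 ≤ τ (a : A)}

variable {A}

/-- `ρ_L(σ, τ) = sup {|σ(a) - τ(a)| : a ∈ A, L(a) ≤ 1}`. -/
noncomputable def traceDist (L : A → ℝ≥0∞) (σ τ : TraceSpace A) : ℝ≥0∞ :=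
  ⨆ (a : A) (_ : L a ≤ 1), ‖(σ : WeakDual ℂ A) a - (τ : WeakDual ℂ A) a‖ₑ

/-- The radius of `(A, L)`: half the `ρ_L`-diameter of `T(A)`. -/
noncomputable def radius (L : A → ℝ≥0∞) : ℝ≥0∞ :=
  (⨆ (σ : TraceSpace A) (τ : TraceSpace A), traceDist L σ τ) / 2

/-- `(A, L)` is a C*-algebraic quantum metric Choquet simplex. (Separability of `A` is a separate
type class assumption in the sequel.) -/
structure IsCStarQMCS (L : A → ℝ≥0∞) : Prop where
  /-- `L` is a seminorm with values in `[0, ∞]` (where `0 · ∞ = 0`) -/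
  add_le : ∀ a b : A, L (a + b) ≤ L a + L b
  smul_eq : ∀ (c : ℂ) (a : A), L (c • a) = ‖c‖ₑ * L a
  /-- `A^q` is tracially ordered -/
  traciallyOrdered : TraciallyOrdered A
  /-- `L` is self-adjoint, lower semicontinuous and densely finite -/
  star_eq : ∀ a : A, L (star a) = L a
  lowerSemicontinuous : LowerSemicontinuous L
  denselyFinite : Dense {a : A | L a < ∞}
  /-- the kernel of `L` is the complex span of `{1} ∪ A₀` -/
  ker_eq : {a : A | L a = 0} =
    Submodule.span ℂ ({(1 : A)} ∪ ((↑) : selfAdjoint A → A) '' (cpNull A : Set (selfAdjoint A)))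
  /-- the topology on `T(A)` induced by the metric `ρ_L` is the w*-topology -/
  isOpen_iff : ∀ U : Set (TraceSpace A), IsOpen U ↔
    ∀ σ ∈ U, ∃ ε : ℝ≥0∞, 0 < ε ∧ ∀ τ : TraceSpace A, traceDist L σ τ < ε → τ ∈ U

/-- The seminorm on `A^q` induced by `L`. When `(A, L)` is a C*-algebraic quantum metric Choquet
simplex, its value at `q(a)` is `L(a)`; see `IsCStarQMCS.quotSeminorm_quot`. -/
noncomputable def quotSeminorm (L : A → ℝ≥0∞) (x : CPQuotient A) : ℝ≥0∞ :=
  ⨅ (a : selfAdjoint A) (_ : quot A a = x), L (a : A)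

theorem IsCStarQMCS.quotSeminorm_quot {L : A → ℝ≥0∞} (hL : IsCStarQMCS L) (a : selfAdjoint A) :
    quotSeminorm L (quot A a) = L (a : A) := by
  refine le_antisymm
    (iInf₂_le (f := fun (b : selfAdjoint A) (_ : quot A b = quot A a) => L (b : A)) a rfl) (le_iInf₂ fun b hb => ?_)
  have hmem : a - b ∈ cpNull A := (Submodule.Quotient.eq _).1 hb.symm
  have h0 : ((a - b : selfAdjoint A) : A) ∈ {a : A | L a = 0} := by
    rw [hL.ker_eq]
    exact Submodule.subset_span (Or.inr ⟨_, hmem, rfl⟩)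
  calc L (a : A) = L (((a - b : selfAdjoint A) : A) + (b : A)) := by simp
    _ ≤ L ((a - b : selfAdjoint A) : A) + L (b : A) := hL.add_le _ _
    _ = L (b : A) := by rw [show L ((a - b : selfAdjoint A) : A) = 0 from h0, zero_add]

end

end CStarQMCS

/-!
The set of classes `x` in `A^q` with `L(x) ≤ 1` and `‖x‖ ≤ r` is shown to be compact, and a compact
set in a quotient of a Banach space by a closed subspace is the image of a compact set
(`Submodule.exists_isCompact_image_mkQ_eq`); such a lift is the nucleus.

The crucial point is that the quotient norm of `q(a)` is exactly `sup |τ(a)|` over the tracial states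
(`norm_quot_le_of_forall_trace`). If `|τ(a)| ≤ s` for every `τ`, then tracial orderedness provides
positive elements `b`, `c` representing `s - a` and `s + a`, and `b ≤ b + c` lies below `2s` modulo
`A₀`. The order relation modulo `A₀` becomes an honest one by replacing `b` by an equivalent element:
writing out the element of `A₀` gives `b + v ≾ (2s + δ) + v` for a finite Cuntz--Pedersen
subequivalence `≾`, where `v` is a partial sum of `∑ xₙ xₙ*`. This relation is additive, and transitive
through invertible elements (`Subequiv.trans`), hence `n b + v ≾ n (2s + δ) + v` for every `n`;
since `v` is bounded, dividing by `n` gives `b ≾ 2s + ε` (`Subequiv.of_add_right`). So `b` is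
equivalent to some `d` in `[0, 2s + ε]`, and `s - d` represents `q(a)` with norm at most `s + ε`.

Therefore `A^q` embeds isometrically in the continuous functions on the compact space `T(A)`, where
the Arzelà--Ascoli theorem applies: functions with `L ≤ 1` are `1`-Lipschitz for `ρ_L`, which induces
the topology of `T(A)` (`IsCStarQMCS.isCompact_quotSeminorm_le`). Lower semicontinuity of `L` makes
both the set and `A₀` closed. Finally, if `L(a) ≤ 1`, the values of `a` at the traces lie in an
interval of length at most `2r`, and subtracting its midpoint from `a` brings the norm of the class
to at most `r` (`IsCStarQMCS.exists_norm_quot_sub_le`).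
-/

/-! ### Lifting compact sets along quotient maps -/

/-- A surjective continuous linear map between Banach spaces is compact-covering. A compact `K` is a
continuous image of the Cantor space `S`, so it suffices to lift a continuous map `S → F` to `E`.
Locally constant maps lift with control of the norm by the open mapping theorem, and they are dense
in `C(S, F)`, so all of `C(S, F)` lifts. -/
theorem ContinuousLinearMap.exists_isCompact_image_eq {E F : Type*} [NormedAddCommGroup E]
    [NormedSpace ℝ E] [CompleteSpace E] [NormedAddCommGroup F] [NormedSpace ℝ F] [CompleteSpace F]
    (f : E →L[ℝ] F) (hf : Function.Surjective f) {K : Set F} (hK : IsCompact K) :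
    ∃ D : Set E, IsCompact D ∧ f '' D = K := by
  rcases K.eq_empty_or_nonempty with rfl | hne
  · exact ⟨∅, isCompact_empty, Set.image_empty _⟩
  have : CompactSpace K := isCompact_iff_compactSpace.mp hK
  have : Nonempty K := hne.to_subtype
  obtain ⟨g, hg, hgsurj⟩ := exists_nat_bool_continuous_surjective_of_compact K
  obtain ⟨C, hC, hpre⟩ := f.exists_preimage_norm_le hf
  choose s hs hsC using hpre
  let Φ : NormedAddGroupHom C(ℕ → Bool, E) C(ℕ → Bool, F) :=
    (f.compLeftContinuous ℝ (ℕ → Bool) : C(ℕ → Bool, E) →+ C(ℕ → Bool, F)).mkNormedAddGroupHom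
      ‖f‖ fun u => (ContinuousMap.norm_le _ (by positivity)).2 fun x =>
        (f.le_opNorm _).trans (by gcongr; exact u.norm_coe_le_norm x)
  have hΦ : ∀ u x, Φ u x = f (u x) := fun u x => rfl
  let LC : AddSubgroup C(ℕ → Bool, F) :=
    (LocallyConstant.toContinuousMapAddMonoidHom :
      LocallyConstant (ℕ → Bool) F →+ C(ℕ → Bool, F)).range
  have hLC : Φ.SurjectiveOnWith LC C := by
    rintro _ ⟨u, rfl⟩
    refine ⟨(u.map s : C(ℕ → Bool, E)), ?_, ?_⟩
    · ext x
      exact hs (u x)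
    · refine (ContinuousMap.norm_le _ (by positivity)).2 fun x => (hsC (u x)).trans ?_
      gcongr
      exact (LocallyConstant.toContinuousMapAddMonoidHom u :
        C(ℕ → Bool, F)).norm_coe_le_norm x
  let g' : C(ℕ → Bool, F) := ⟨fun x => (g x : F), by fun_prop⟩
  have hg' : g' ∈ LC.topologicalClosure := by
    refine Metric.mem_closure_iff.2 fun ε hε => ?_
    obtain ⟨n, p, h, hp, hph⟩ := ContinuousMap.exists_finite_approximation_of_mem_nhds_diagonal g'
      (nhdsSet_diagonal_le_uniformity (Metric.dist_mem_uniformity (half_pos hε)))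
    let u : LocallyConstant (ℕ → Bool) F :=
      ⟨h ∘ p, ((IsLocallyConstant.iff_continuous p).2 hp).comp h⟩
    refine ⟨_, ⟨u, rfl⟩, lt_of_le_of_lt ?_ (half_lt_self hε)⟩
    exact (ContinuousMap.dist_le (by positivity)).2 fun x => (hph x).le
  obtain ⟨u, hu, -⟩ := controlled_closure_of_complete hC one_pos hLC g' hg'
  refine ⟨Set.range u, isCompact_range u.continuous, ?_⟩
  rw [← Set.range_comp]
  have : f ∘ u = Subtype.val ∘ g := by
    ext x
    exact (hΦ u x).symm.trans (by rw [hu]; rfl)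
  rw [this, Set.range_comp, hgsurj.range_eq, Set.image_univ, Subtype.range_coe]

/-- A compact subset of the quotient of a Banach space by a closed subspace lifts to a compact
subset of the space. -/
theorem Submodule.exists_isCompact_image_mkQ_eq {E : Type*} [NormedAddCommGroup E]
    [NormedSpace ℝ E] [CompleteSpace E] (S : Submodule ℝ E) (hS : IsClosed (S : Set E))
    {K : Set (E ⧸ S)} (hK : IsCompact K) : ∃ D : Set E, IsCompact D ∧ S.mkQ '' D = K :=
  ContinuousLinearMap.exists_isCompact_image_eq ⟨S.mkQ, continuous_quot_mk⟩ S.mkQ_surjective hK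

namespace CStarQMCS

/-! ### Cuntz--Pedersen subequivalence of positive elements -/

section Subequivalence

variable {A : Type*} [CStarAlgebra A]

theorem CPEquiv.star_mul_self (x : A) : CPEquiv (star x * x) (x * star x) := by
  refine ⟨fun n => if n = 0 then x else 0, ?_, ?_⟩
  · convert hasSum_ite_eq (0 : ℕ) (star x * x) using 2 with n
    by_cases hn : n = 0 <;> simp [hn]
  · convert hasSum_ite_eq (0 : ℕ) (x * star x) using 2 with n
    by_cases hn : n = 0 <;> simp [hn]

theorem CPEquiv.sum {ι : Type*} (s : Finset ι) (x : ι → A) :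
    CPEquiv (∑ i ∈ s, star (x i) * x i) (∑ i ∈ s, x i * star (x i)) := by
  classical
  induction s using Finset.induction_on with
  | empty => simpa using CPEquiv.star_mul_self (0 : A)
  | insert i s hi ih =>
    rw [Finset.sum_insert hi, Finset.sum_insert hi]
    exact (CPEquiv.star_mul_self (x i)).add ih

variable [PartialOrder A]

/-- Finite Cuntz--Pedersen subequivalence, written `a ≾ b` in comments: `a = ∑ xᵢ* xᵢ` for a finite
family with `∑ xᵢ xᵢ* ≤ b`. Finite families suffice here because series are only ever needed up to
`ε`. -/
def Subequiv (a b : A) : Prop :=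
  ∃ (ι : Type) (_ : Fintype ι) (x : ι → A),
    ∑ i, star (x i) * x i = a ∧ ∑ i, x i * star (x i) ≤ b

theorem Subequiv.mono {a b c : A} (h : Subequiv a b) (hbc : b ≤ c) : Subequiv a c := by
  obtain ⟨ι, _, x, h1, h2⟩ := h
  exact ⟨ι, _, x, h1, h2.trans hbc⟩

variable [StarOrderedRing A]

theorem subequiv_of_le {a b : A} (ha : 0 ≤ a) (hab : a ≤ b) : Subequiv a b := by
  have hs : star (CFC.sqrt a) = CFC.sqrt a := (CFC.sqrt_nonneg a).isSelfAdjoint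
  exact ⟨Unit, inferInstance, fun _ => CFC.sqrt a, by simp [hs, CFC.sqrt_mul_sqrt_self a ha],
    by simpa [hs, CFC.sqrt_mul_sqrt_self a ha]⟩

theorem Subequiv.add {a b c d : A} (h : Subequiv a b) (h' : Subequiv c d) :
    Subequiv (a + c) (b + d) := by
  obtain ⟨ι, _, x, rfl, h2⟩ := h
  obtain ⟨κ, _, y, rfl, h4⟩ := h'
  exact ⟨ι ⊕ κ, inferInstance, Sum.elim x y, by simp, by simpa using add_le_add h2 h4⟩

theorem Subequiv.smul {a b : A} (h : Subequiv a b) {t : ℝ} (ht : 0 ≤ t) :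
    Subequiv (t • a) (t • b) := by
  obtain ⟨ι, _, x, rfl, h2⟩ := h
  refine ⟨ι, inferInstance, fun i => √t • x i, ?_, ?_⟩
  · simp [smul_smul, Real.mul_self_sqrt ht, Finset.smul_sum]
  · simpa [smul_smul, Real.mul_self_sqrt ht, Finset.smul_sum] using smul_le_smul_of_nonneg_left h2 ht

/-- Transitivity through a strictly positive `b`: if `a = ∑ xᵢ* xᵢ` and `b = ∑ yⱼ* yⱼ`, then the
elements `yⱼ b^(-1/2) xᵢ` witness the composite relation. -/
theorem Subequiv.trans {a b c : A} (h : Subequiv a b) (h' : Subequiv b c)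
    (hb : IsStrictlyPositive b) : Subequiv a c := by
  obtain ⟨ι, _, x, rfl, hx⟩ := h
  obtain ⟨κ, _, y, hy, hc⟩ := h'
  set w : A := b ^ (-(1 / 2) : ℝ) with hw
  have hwb : w * b * w = 1 := CFC.conjugate_rpow_neg_one_half b hb
  have hws : star w = w := (CFC.rpow_nonneg (a := b)).isSelfAdjoint
  refine ⟨ι × κ, inferInstance, fun p => y p.2 * w * x p.1, ?_, ?_⟩
  · rw [Fintype.sum_prod_type]
    refine Finset.sum_congr rfl fun i _ => ?_
    calc ∑ j, star (y j * w * x i) * (y j * w * x i)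
        = star (x i) * (w * (∑ j, star (y j) * y j) * w) * x i := by
          simp only [Finset.mul_sum, Finset.sum_mul, star_mul, hws, mul_assoc]
      _ = star (x i) * x i := by rw [hy, hwb, mul_one]
  · rw [Fintype.sum_prod_type_right]
    refine (Finset.sum_le_sum fun j _ => ?_).trans hc
    calc ∑ i, y j * w * x i * star (y j * w * x i)
        = y j * (w * (∑ i, x i * star (x i)) * star w) * star (y j) := by
          simp only [Finset.mul_sum, Finset.sum_mul, star_mul, hws, mul_assoc]
      _ ≤ y j * (w * b * star w) * star (y j) :=
          star_right_conjugate_le_conjugate (star_right_conjugate_le_conjugate hx _) _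
      _ = y j * star (y j) := by rw [hws, hwb, mul_one]

theorem isStrictlyPositive_smul_one {t : ℝ} (ht : 0 < t) : IsStrictlyPositive (t • (1 : A)) :=
  IsStrictlyPositive.smul ht isStrictlyPositive_one

/-- Cancellation up to `ε`: a summand common to both sides can be dropped, because
`n b + v ≾ n t + v` follows by induction and the contribution of `v` becomes negligible after
division by `n`. -/
theorem Subequiv.of_add_right {b v : A} (hb : 0 ≤ b) (hv : 0 ≤ v) {t : ℝ} (ht : 0 < t)
    (h : Subequiv (b + v) (t • 1 + v)) {ε : ℝ} (hε : 0 < ε) :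
    Subequiv b ((t + ε) • 1) := by
  have ht1 : IsStrictlyPositive (t • (1 : A)) := isStrictlyPositive_smul_one ht
  have key : ∀ n : ℕ, Subequiv ((n : ℝ) • b + v) (((n : ℝ) * t) • 1 + v) := by
    intro n
    induction n with
    | zero => simpa using subequiv_of_le hv le_rfl
    | succ n ih =>
      have hnb : 0 ≤ (n : ℝ) • b := smul_nonneg n.cast_nonneg hb
      have h1 := (subequiv_of_le hnb le_rfl).add h
      have h2 := ih.add (subequiv_of_le ht1.nonneg le_rfl)
      have e1 : (n : ℝ) • b + (b + v) = ((n + 1 : ℕ) : ℝ) • b + v := by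
        push_cast; rw [add_smul, one_smul, add_assoc]
      have e2 : (n : ℝ) • b + (t • 1 + v) = (n : ℝ) • b + v + t • 1 := by abel
      have e3 : ((n : ℝ) * t) • (1 : A) + v + t • 1 = (((n + 1 : ℕ) : ℝ) * t) • 1 + v := by
        push_cast; rw [add_mul, add_smul, one_mul]; abel
      rw [e1, e2] at h1
      rw [e3] at h2
      exact h1.trans h2 (ht1.nonneg_add (add_nonneg hnb hv))
  -- The extra `1` makes the middle term `n b + v + 1` invertible, as transitivity requires.
  obtain ⟨n, hn⟩ := exists_nat_gt ((‖v‖ + 1) / ε)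
  have hn0 : (0 : ℝ) < n := lt_of_le_of_lt (by positivity) hn
  have hnε : ‖v‖ + 1 ≤ n * ε := ((div_lt_iff₀ hε).1 hn).le
  have h11 : IsStrictlyPositive (1 : A) := isStrictlyPositive_one
  have hnb : 0 ≤ (n : ℝ) • b := smul_nonneg hn0.le hb
  have h1 : Subequiv ((n : ℝ) • b) ((n : ℝ) • b + v + 1) :=
    subequiv_of_le hnb (by rw [add_assoc]; exact le_add_of_nonneg_right (add_nonneg hv h11.nonneg))
  have h2 := (key n).add (subequiv_of_le h11.nonneg le_rfl)
  have hvn : v ≤ ‖v‖ • (1 : A) := by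
    simpa [Algebra.algebraMap_eq_smul_one] using
      IsSelfAdjoint.le_algebraMap_norm_self (a := v) hv.isSelfAdjoint
  have h3 : ((n : ℝ) * t) • (1 : A) + v + 1 ≤ (n * (t + ε)) • 1 := by
    calc ((n : ℝ) * t) • (1 : A) + v + 1 ≤ ((n : ℝ) * t) • (1 : A) + ‖v‖ • 1 + (1 : ℝ) • 1 := by
          rw [one_smul]; gcongr
      _ = (n * t + (‖v‖ + 1)) • (1 : A) := by simp only [add_smul]; abel
      _ ≤ (n * (t + ε)) • 1 := smul_le_smul_of_nonneg_right (by linarith) h11.nonneg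
  have h4 := ((h1.trans h2 (h11.nonneg_add (add_nonneg hnb hv))).mono h3).smul
    (inv_nonneg.2 hn0.le)
  rwa [smul_smul, smul_smul, inv_mul_cancel₀ hn0.ne', one_smul, ← mul_assoc,
    inv_mul_cancel₀ hn0.ne', one_mul] at h4

/-- A positive element that is at most `t + n` with `n ∈ A₀` can be moved, within its class
modulo `A₀`, into the order interval `[0, t + ε]`. -/
theorem exists_le_of_le_add_cpNull {b : selfAdjoint A} (hb : 0 ≤ (b : A)) {t : ℝ} (ht : 0 ≤ t)
    {n : selfAdjoint A} (hn : n ∈ cpNull A) (hbn : (b : A) ≤ t • 1 + (n : A)) {ε : ℝ}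
    (hε : 0 < ε) :
    ∃ c : selfAdjoint A, 0 ≤ (c : A) ∧ (c : A) ≤ (t + ε) • 1 ∧ b - c ∈ cpNull A := by
  obtain ⟨p, q, -, -, ⟨x, hp, hq⟩, hnpq⟩ := hn
  have hlim : HasSum (fun k => star (x k) * x k - x k * star (x k)) (n : A) := by
    rw [hnpq]; exact hp.sub hq
  obtain ⟨s, hs⟩ : ∃ s : Finset ℕ,
      ‖(n : A) - ∑ k ∈ s, (star (x k) * x k - x k * star (x k))‖ < ε / 2 := by
    obtain ⟨s, hs⟩ := (Metric.tendsto_atTop.1 hlim (ε / 2) (half_pos hε))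
    exact ⟨s, by simpa [dist_eq_norm, norm_sub_rev] using hs s le_rfl⟩
  set w : A := ∑ k ∈ s, star (x k) * x k with hw
  set v : A := ∑ k ∈ s, x k * star (x k) with hv
  have hv0 : 0 ≤ v := Finset.sum_nonneg fun k _ => mul_star_self_nonneg _
  have hw0 : 0 ≤ w := Finset.sum_nonneg fun k _ => star_mul_self_nonneg _
  have hwv : Subequiv w v := ⟨s, inferInstance, fun k => x k,
    Finset.sum_coe_sort s fun k => star (x k) * x k,
    (Finset.sum_coe_sort s fun k => x k * star (x k)).le⟩
  have hε2 : 0 < t + ε / 2 := by positivity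
  have hnle : (n : A) ≤ (ε / 2) • 1 + (w - v) := by
    rw [Finset.sum_sub_distrib, ← hw, ← hv] at hs
    have hsa : IsSelfAdjoint ((n : A) - (w - v)) :=
      n.2.sub (hw0.isSelfAdjoint.sub hv0.isSelfAdjoint)
    rw [← sub_le_iff_le_add]
    refine hsa.le_algebraMap_norm_self.trans ?_
    rw [Algebra.algebraMap_eq_smul_one]
    exact smul_le_smul_of_nonneg_right hs.le isStrictlyPositive_one.nonneg
  have hle : (b : A) + v ≤ (t + ε / 2) • 1 + w := by
    calc (b : A) + v ≤ t • 1 + ((ε / 2) • 1 + (w - v)) + v := by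
          gcongr; exact hbn.trans (by gcongr)
      _ = (t + ε / 2) • 1 + w := by rw [add_smul]; abel
  have hpos := isStrictlyPositive_smul_one (A := A) hε2
  -- `b + v ≤ t + ε / 2 + w`, and `w ≾ v` through the elements `x k`.
  have h1 : Subequiv ((b : A) + v) ((t + ε / 2) • 1 + v) :=
    (subequiv_of_le (add_nonneg hb hv0) hle).trans
      ((subequiv_of_le hpos.nonneg le_rfl).add hwv) (hpos.add_nonneg hw0)
  obtain ⟨ι, _, y, hy1, hy2⟩ := h1.of_add_right hb hv0 hε2 (half_pos hε)
  have hc0 : 0 ≤ ∑ i, y i * star (y i) := Finset.sum_nonneg fun i _ => mul_star_self_nonneg _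
  refine ⟨⟨_, hc0.isSelfAdjoint⟩, hc0, ?_, ?_⟩
  · rwa [add_assoc, add_halves] at hy2
  · exact ⟨b, _, hb, hc0, hy1 ▸ CPEquiv.sum Finset.univ y, rfl⟩

end Subequivalence

/-! ### The norm of the quotient as a supremum over traces -/

section Traces

variable {A : Type*} [CStarAlgebra A] [PartialOrder A]

theorem trace_eq_of_cpEquiv {τ : WeakDual ℂ A} (hτ : τ ∈ tracialStates A) {a b : A}
    (h : CPEquiv a b) : τ a = τ b := by
  obtain ⟨x, ha, hb⟩ := h
  have h1 := ha.map τ (map_continuous τ)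
  have h2 := hb.map τ (map_continuous τ)
  refine h1.unique ?_
  convert h2 using 1
  funext n
  exact hτ.2.2 _ _

theorem trace_smul_one {τ : WeakDual ℂ A} (hτ : τ ∈ tracialStates A) (t : ℝ) :
    τ (t • (1 : A)) = t := by
  rw [← Complex.coe_smul t (1 : A), map_smul, hτ.2.1, smul_eq_mul, mul_one]

variable [StarOrderedRing A]

theorem _root_.IsSelfAdjoint.norm_le_of_mem_Icc {a : A} (ha : IsSelfAdjoint a) {r : ℝ} (hr : 0 ≤ r)
    (h₁ : -(r • 1) ≤ a) (h₂ : a ≤ r • 1) : ‖a‖ ≤ r := by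
  obtain h | h := subsingleton_or_nontrivial A
  · simpa [Subsingleton.elim a 0] using hr
  rw [← neg_smul, ← Algebra.algebraMap_eq_smul_one, algebraMap_le_iff_le_spectrum] at h₁
  rw [← Algebra.algebraMap_eq_smul_one, le_algebraMap_iff_spectrum_le] at h₂
  rcases CStarAlgebra.norm_or_neg_norm_mem_spectrum ha with h | h
  · exact h₂ _ h
  · exact neg_le_neg_iff.1 (h₁ _ h)

theorem trace_cpNull {τ : WeakDual ℂ A} (hτ : τ ∈ tracialStates A) {n : selfAdjoint A}
    (hn : n ∈ cpNull A) : τ (n : A) = 0 := by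
  obtain ⟨a, b, -, -, h, hab⟩ := hn
  rw [hab, map_sub, trace_eq_of_cpEquiv hτ h, sub_self]

theorem trace_im_eq_zero {τ : WeakDual ℂ A} (hτ : τ ∈ tracialStates A) (a : selfAdjoint A) :
    (τ (a : A)).im = 0 := by
  have h := a.2.le_algebraMap_norm_self
  rw [Algebra.algebraMap_eq_smul_one, ← sub_nonneg] at h
  have := (Complex.le_def.1 (hτ.1 _ h)).2
  rw [map_sub, trace_smul_one hτ] at this
  simpa using this.symm

theorem ofReal_trace_re {τ : WeakDual ℂ A} (hτ : τ ∈ tracialStates A) (a : selfAdjoint A) :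
    ((τ (a : A)).re : ℂ) = τ (a : A) :=
  Complex.ext rfl (trace_im_eq_zero hτ a).symm

theorem trace_re_le_norm {τ : WeakDual ℂ A} (hτ : τ ∈ tracialStates A) (a : selfAdjoint A) :
    (τ (a : A)).re ≤ ‖a‖ := by
  have h := a.2.le_algebraMap_norm_self
  rw [Algebra.algebraMap_eq_smul_one, ← sub_nonneg] at h
  have := (Complex.le_def.1 (hτ.1 _ h)).1
  rw [map_sub, trace_smul_one hτ] at this
  simpa using this

theorem abs_trace_re_le_norm {τ : WeakDual ℂ A} (hτ : τ ∈ tracialStates A) (a : selfAdjoint A) :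
    |(τ (a : A)).re| ≤ ‖a‖ := by
  refine abs_le'.2 ⟨trace_re_le_norm hτ a, ?_⟩
  simpa using trace_re_le_norm hτ (-a)

theorem norm_trace_le {τ : WeakDual ℂ A} (hτ : τ ∈ tracialStates A) (a : A) :
    ‖τ a‖ ≤ 2 * ‖a‖ := by
  have h : ∀ b : selfAdjoint A, ‖τ (b : A)‖ ≤ ‖b‖ := fun b => by
    rw [← ofReal_trace_re hτ b, Complex.norm_real]
    exact abs_trace_re_le_norm hτ b
  calc ‖τ a‖ = ‖τ (realPart a : A) + Complex.I • τ (imaginaryPart a : A)‖ := by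
        rw [← map_smul, ← map_add, realPart_add_I_smul_imaginaryPart]
    _ ≤ ‖τ (realPart a : A)‖ + ‖τ (imaginaryPart a : A)‖ := by
        refine (norm_add_le _ _).trans ?_
        rw [norm_smul, Complex.norm_I, one_mul]
    _ ≤ ‖a‖ + ‖a‖ := add_le_add ((h _).trans (realPart.norm_le a))
        ((h _).trans (imaginaryPart.norm_le a))
    _ = 2 * ‖a‖ := by ring

theorem isCompact_tracialStates : IsCompact (tracialStates A) := by
  refine WeakDual.isCompact_of_bounded_of_closed ?_ ?_
  · refine isBounded_iff_forall_norm_le.2 ⟨2, fun τ hτ => ?_⟩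
    exact ContinuousLinearMap.opNorm_le_bound _ zero_le_two fun a => norm_trace_le hτ a
  · have hev : ∀ a : A, Continuous fun τ : WeakDual ℂ A => τ a := fun a => WeakDual.eval_continuous a
    simp only [tracialStates, Set.ofPred_and, Set.ofPred_forall]
    refine (isClosed_iInter fun a => isClosed_iInter fun _ => ?_).inter
      ((isClosed_eq (hev 1) continuous_const).inter
        (isClosed_iInter fun a => isClosed_iInter fun b => isClosed_eq (hev _) (hev _)))
    exact isClosed_le continuous_const (hev a)

instance : CompactSpace (TraceSpace A) := isCompact_iff_compactSpace.mp isCompact_tracialStates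

/-- If `A^q` is tracially ordered, its norm is at most the supremum norm over the trace space: the
order interval `[-s, s]` of `A_sa` maps onto that of `A^q`, up to `ε`. -/
theorem norm_quot_le_of_forall_trace (hA : TraciallyOrdered A) (a : selfAdjoint A) {s : ℝ}
    (h : ∀ τ ∈ tracialStates A, |(τ (a : A)).re| ≤ s) : ‖quot A a‖ ≤ s := by
  obtain ⟨τ₀, hτ₀⟩ := hA.1
  have hs : 0 ≤ s := (abs_nonneg _).trans (h τ₀ hτ₀)
  have hpos : ∀ x : selfAdjoint A, (∀ τ ∈ tracialStates A, |(τ (x : A)).re| ≤ s) →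
      ∃ b : selfAdjoint A, 0 ≤ (b : A) ∧ b - (s • 1 + x) ∈ cpNull A := by
    intro x hx
    have hmem : quot A (s • 1 + x) ∈ posCone A := by
      rw [hA.2]
      refine ⟨_, fun τ hτ => ?_, rfl⟩
      have e : ((s • 1 + x : selfAdjoint A) : A) = s • (1 : A) + (x : A) := by simp
      rw [e, map_add, trace_smul_one hτ, ← ofReal_trace_re hτ x, ← Complex.ofReal_add,
        Complex.zero_le_real]
      linarith [neg_le_of_abs_le (hx τ hτ)]
    obtain ⟨b, hb, hbx⟩ := hmem
    exact ⟨b, hb, (Submodule.Quotient.eq _).1 hbx⟩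
  obtain ⟨b, hb, hbn⟩ := hpos (-a) fun τ hτ => by simpa using h τ hτ
  obtain ⟨c, hc, hcn⟩ := hpos a h
  have hle : (b : A) ≤ (2 * s) • 1 +
      ((b - (s • 1 + -a) + (c - (s • 1 + a)) : selfAdjoint A) : A) := by
    have e : (2 * s) • 1 + ((b - (s • 1 + -a) + (c - (s • 1 + a)) : selfAdjoint A) : A)
        = (b : A) + (c : A) := by
      simp only [AddSubgroup.coe_add, AddSubgroup.coe_sub, selfAdjoint.val_smul, selfAdjoint.val_one,
        AddSubgroup.coe_neg, two_mul, add_smul]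
      abel
    rw [e]
    exact le_add_of_nonneg_right hc
  refine le_of_forall_pos_le_add fun ε hε => ?_
  obtain ⟨d, hd0, hd, hdn⟩ := exists_le_of_le_add_cpNull hb (by positivity)
    ((cpNull A).add_mem hbn hcn) hle hε
  -- `d` is congruent to `b`, hence to `s - a`, modulo `A₀`, so `s - d` is a
  -- representative of `q(a)` in the order interval `[-(s + ε), s]`.
  have hq : quot A a = quot A (s • 1 - d) := by
    refine (Submodule.Quotient.eq _).2 ?_
    have := (cpNull A).sub_mem hbn hdn
    convert this using 1
    abel
  rw [hq]
  refine (Submodule.Quotient.norm_mk_le _ _).trans ?_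
  have hone : (0 : A) ≤ 1 := isStrictlyPositive_one.nonneg
  have hval : ((s • 1 - d : selfAdjoint A) : A) = s • (1 : A) - (d : A) := by simp
  change ‖((s • 1 - d : selfAdjoint A) : A)‖ ≤ s + ε
  refine (s • 1 - d : selfAdjoint A).2.norm_le_of_mem_Icc (by positivity) ?_ ?_
  · rw [hval, neg_le_sub_iff_le_add]
    refine hd.trans_eq ?_
    rw [← add_smul]
    ring_nf
  · rw [hval]
    exact (sub_le_self _ hd0).trans (smul_le_smul_of_nonneg_right (by linarith) hone)

/-- Evaluation of the classes in `A^q` at the traces, a linear map into the real continuous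
functions on the compact space `T(A)`. -/
noncomputable def traceEval : CPQuotient A →ₗ[ℝ] BoundedContinuousFunction (TraceSpace A) ℝ :=
  (cpNull A).liftQ
    { toFun := fun a => BoundedContinuousFunction.mkOfCompact
        ⟨fun τ => ((τ : WeakDual ℂ A) (a : A)).re, Complex.continuous_re.comp
          ((WeakDual.eval_continuous (a : A)).comp continuous_subtype_val)⟩
      map_add' := fun a b => by ext τ; simp
      map_smul' := fun t a => by
        ext τ
        change ((τ : WeakDual ℂ A) (t • (a : A))).re = t * ((τ : WeakDual ℂ A) (a : A)).re
        rw [← Complex.coe_smul t (a : A), map_smul, smul_eq_mul, Complex.re_ofReal_mul] }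
    fun n hn => by
      ext τ
      simp [trace_cpNull τ.2 hn]

theorem norm_traceEval (hA : TraciallyOrdered A) (x : CPQuotient A) : ‖traceEval x‖ = ‖x‖ := by
  refine le_antisymm ?_ ?_
  · refine (BoundedContinuousFunction.norm_le (norm_nonneg _)).2 fun τ =>
      le_of_forall_pos_le_add fun ε hε => ?_
    obtain ⟨a, rfl, ha⟩ := Submodule.Quotient.norm_mk_lt x hε
    exact (abs_trace_re_le_norm τ.2 a).trans ha.le
  · obtain ⟨a, rfl⟩ := (cpNull A).mkQ_surjective x
    exact norm_quot_le_of_forall_trace hA a fun τ hτ =>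
      (traceEval (quot A a)).norm_coe_le_norm ⟨τ, hτ⟩

end Traces

/-! ### Compactness of the Lipschitz ball -/

section QuantumMetric

variable {A : Type*} [CStarAlgebra A]

instance completeSpace_selfAdjoint : CompleteSpace (selfAdjoint A) :=
  (isClosed_eq continuous_star continuous_id : IsClosed {a : A | star a = a}).completeSpace_coe

theorem realPart_imaginaryPart_mem_of_mem_span (N : Submodule ℝ (selfAdjoint A)) {x : A}
    (hx : x ∈ Submodule.span ℂ (((↑) : selfAdjoint A → A) '' (N : Set (selfAdjoint A)))) :
    realPart x ∈ N ∧ imaginaryPart x ∈ N := by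
  induction hx using Submodule.span_induction with
  | mem x hx =>
    obtain ⟨n, hn, rfl⟩ := hx
    refine ⟨by simpa using hn, ?_⟩
    rw [n.2.imaginaryPart]
    exact N.zero_mem
  | zero => simp
  | add x y _ _ hx hy => simpa using ⟨N.add_mem hx.1 hy.1, N.add_mem hx.2 hy.2⟩
  | smul c x _ hx =>
    rw [realPart_smul, imaginaryPart_smul]
    exact ⟨N.sub_mem (N.smul_mem _ hx.1) (N.smul_mem _ hx.2),
      N.add_mem (N.smul_mem _ hx.2) (N.smul_mem _ hx.1)⟩

variable [PartialOrder A] {L : A → ℝ≥0∞}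

theorem traceDist_triangle (L : A → ℝ≥0∞) (σ τ υ : TraceSpace A) :
    traceDist L σ υ ≤ traceDist L σ τ + traceDist L τ υ := by
  refine iSup₂_le fun a ha => ?_
  calc ‖(σ : WeakDual ℂ A) a - (υ : WeakDual ℂ A) a‖ₑ
      = ‖((σ : WeakDual ℂ A) a - (τ : WeakDual ℂ A) a) +
          ((τ : WeakDual ℂ A) a - (υ : WeakDual ℂ A) a)‖ₑ := by rw [sub_add_sub_cancel]
    _ ≤ _ := enorm_add_le _ _
    _ ≤ _ := add_le_add (le_iSup₂ (f := fun (a : A) (_ : L a ≤ 1) =>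
          ‖(σ : WeakDual ℂ A) a - (τ : WeakDual ℂ A) a‖ₑ) a ha)
        (le_iSup₂ (f := fun (a : A) (_ : L a ≤ 1) =>
          ‖(τ : WeakDual ℂ A) a - (υ : WeakDual ℂ A) a‖ₑ) a ha)

theorem enorm_trace_re_sub_le (a : selfAdjoint A) (ha : L (a : A) ≤ 1) (σ τ : TraceSpace A) :
    ‖((σ : WeakDual ℂ A) (a : A)).re - ((τ : WeakDual ℂ A) (a : A)).re‖ₑ ≤ traceDist L σ τ := by
  refine le_trans ?_ (le_iSup₂ (f := fun (a : A) (_ : L a ≤ 1) =>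
    ‖(σ : WeakDual ℂ A) a - (τ : WeakDual ℂ A) a‖ₑ) (a : A) ha)
  rw [← ofReal_norm, ← ofReal_norm, ← Complex.sub_re]
  exact ENNReal.ofReal_le_ofReal (Complex.abs_re_le_norm _)

variable [StarOrderedRing A]

theorem IsCStarQMCS.apply_cpNull (hL : IsCStarQMCS L) {n : selfAdjoint A} (hn : n ∈ cpNull A) :
    L (n : A) = 0 := by
  change (n : A) ∈ {a : A | L a = 0}
  rw [hL.ker_eq]
  exact Submodule.subset_span (Or.inr ⟨n, hn, rfl⟩)

theorem IsCStarQMCS.apply_smul_one (hL : IsCStarQMCS L) (t : ℝ) : L (t • (1 : A)) = 0 := by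
  change t • (1 : A) ∈ {a : A | L a = 0}
  rw [hL.ker_eq, ← Complex.coe_smul t (1 : A)]
  exact Submodule.smul_mem _ _ (Submodule.subset_span (Or.inl rfl))

/-- `A₀` is closed: `L` is lower semicontinuous, so its kernel, whose self-adjoint part is
`ℝ1 + A₀`, is closed, and a tracial state separates `A₀` from the nonzero multiples of `1`. -/
theorem IsCStarQMCS.isClosed_cpNull (hL : IsCStarQMCS L) :
    IsClosed (cpNull A : Set (selfAdjoint A)) := by
  refine isClosed_of_closure_subset fun a ha => ?_
  have hker : IsClosed {a : selfAdjoint A | L (a : A) = 0} := by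
    have : IsClosed (L ⁻¹' Set.Iic 0) := hL.lowerSemicontinuous.isClosed_preimage 0
    simpa [Set.preimage, nonpos_iff_eq_zero] using this.preimage continuous_subtype_val
  have haL : L (a : A) = 0 := closure_minimal (fun n hn => hL.apply_cpNull hn) hker ha
  obtain ⟨τ, hτ⟩ := hL.traciallyOrdered.1
  have haτ : τ (a : A) = 0 := by
    have hcl : IsClosed {a : selfAdjoint A | τ (a : A) = 0} :=
      isClosed_eq ((map_continuous τ).comp continuous_subtype_val) continuous_const
    exact closure_minimal (fun n hn => trace_cpNull hτ hn) hcl ha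
  have hspan : (a : A) ∈ Submodule.span ℂ (((↑) : selfAdjoint A → A) ''
      ((Submodule.span ℝ {1} ⊔ cpNull A : Submodule ℝ (selfAdjoint A)) : Set (selfAdjoint A))) := by
    have h : (a : A) ∈ {a : A | L a = 0} := haL
    rw [hL.ker_eq] at h
    refine Submodule.span_mono ?_ h
    rintro _ (rfl | ⟨n, hn, rfl⟩)
    · exact ⟨1, Submodule.mem_sup_left (Submodule.mem_span_singleton_self 1), rfl⟩
    · exact ⟨n, Submodule.mem_sup_right hn, rfl⟩
  have hmem := (realPart_imaginaryPart_mem_of_mem_span _ hspan).1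
  rw [show realPart (a : A) = a from Subtype.ext a.2.coe_realPart] at hmem
  obtain ⟨u, hu, n, hn, hun⟩ := Submodule.mem_sup.1 hmem
  obtain ⟨t, rfl⟩ := Submodule.mem_span_singleton.1 hu
  have ht : t = 0 := by
    rw [← hun] at haτ
    simpa [trace_smul_one hτ, trace_cpNull hτ hn] using haτ
  rw [ht, zero_smul, zero_add] at hun
  exact hun ▸ hn

theorem IsCStarQMCS.eventually_traceDist_lt (hL : IsCStarQMCS L) (σ : TraceSpace A) {ε : ℝ≥0∞}
    (hε : 0 < ε) : ∀ᶠ τ in 𝓝 σ, traceDist L σ τ < ε := by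
  have hopen : IsOpen {τ | traceDist L σ τ < ε} := by
    rw [hL.isOpen_iff]
    intro τ hτ
    refine ⟨ε - traceDist L σ τ, tsub_pos_of_lt hτ, fun υ hυ => ?_⟩
    exact (traceDist_triangle L σ τ υ).trans_lt (lt_tsub_iff_left.1 hυ)
  refine hopen.mem_nhds ?_
  simpa [traceDist] using hε

/-- The elements of `A^q` of seminorm at most `1` and norm at most `r` form a compact set: evaluated
at the traces, they are an equibounded and equicontinuous family of functions. -/
theorem IsCStarQMCS.isCompact_quotSeminorm_le (hL : IsCStarQMCS L) (r : ℝ) :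
    IsCompact {x : CPQuotient A | quotSeminorm L x ≤ 1 ∧ ‖x‖ ≤ r} := by
  set K := {x : CPQuotient A | quotSeminorm L x ≤ 1 ∧ ‖x‖ ≤ r}
  have hiso : Isometry (traceEval (A := A)) :=
    AddMonoidHomClass.isometry_of_norm _ (norm_traceEval hL.traciallyOrdered)
  have himage : IsCompact (closure (traceEval '' K)) := by
    refine BoundedContinuousFunction.arzela_ascoli (Metric.closedBall 0 r)
      (isCompact_closedBall 0 r) _ ?_ fun σ => Metric.equicontinuousAt_iff_right.2 fun ε hε => ?_
    · rintro _ τ ⟨x, hx, rfl⟩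
      rw [mem_closedBall_zero_iff]
      refine ((traceEval x).norm_coe_le_norm τ).trans ?_
      rw [norm_traceEval hL.traciallyOrdered]
      exact hx.2
    · filter_upwards [hL.eventually_traceDist_lt σ (ENNReal.ofReal_pos.2 hε)] with τ hτ
      rintro ⟨_, x, hx, rfl⟩
      obtain ⟨a, rfl⟩ := (cpNull A).mkQ_surjective x
      have ha : L (a : A) ≤ 1 := hL.quotSeminorm_quot a ▸ hx.1
      have := (enorm_trace_re_sub_le a ha σ τ).trans_lt hτ
      rw [← ofReal_norm, ENNReal.ofReal_lt_ofReal_iff hε] at this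
      exact this
  have hbdd : TotallyBounded K :=
    (totallyBounded_preimage hiso.isUniformInducing
      (himage.totallyBounded.subset subset_closure)).subset (Set.subset_preimage_image _ _)
  refine hbdd.isCompact_of_isClosed ?_
  have hclosed : IsClosed {x : CPQuotient A | quotSeminorm L x ≤ 1} := by
    have hq : Topology.IsQuotientMap (quot A) := isQuotientMap_quot_mk
    refine hq.isClosed_preimage.1 ?_
    have : IsClosed (L ⁻¹' Set.Iic 1) := hL.lowerSemicontinuous.isClosed_preimage 1
    convert this.preimage (continuous_subtype_val (p := fun a : A => a ∈ selfAdjoint A)) using 1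
    ext a
    exact (congrArg (· ≤ 1) (hL.quotSeminorm_quot a)).to_iff
  exact hclosed.inter (isClosed_le continuous_norm continuous_const)

/-- An element of seminorm at most `1` can be translated by a real scalar (the midpoint of the
range of its values at the traces) so that its class in `A^q` has norm at most the radius. -/
theorem IsCStarQMCS.exists_norm_quot_sub_le (hL : IsCStarQMCS L) {r : ℝ≥0}
    (hr : radius L ≤ (r : ℝ≥0∞)) (a : selfAdjoint A) (ha : L (a : A) ≤ 1) :
    ∃ t : ℝ, ‖quot A (a - t • 1)‖ ≤ r := by
  have : Nonempty (TraceSpace A) := hL.traciallyOrdered.1.to_subtype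
  let f : TraceSpace A → ℝ := fun τ => ((τ : WeakDual ℂ A) (a : A)).re
  have hf : ∀ σ τ, f σ ≤ f τ + 2 * r := by
    intro σ τ
    have h1 : traceDist L σ τ ≤ ENNReal.ofReal (2 * r) := by
      have h2 : (⨆ (σ : TraceSpace A) (τ : TraceSpace A), traceDist L σ τ) ≤ r * 2 :=
        (ENNReal.div_le_iff two_ne_zero ENNReal.ofNat_ne_top).1 hr
      refine (le_iSup₂ (f := fun σ τ : TraceSpace A => traceDist L σ τ) σ τ).trans (h2.trans_eq ?_)
      rw [mul_comm, ENNReal.ofReal_mul zero_le_two]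
      simp
    have h2 := (enorm_trace_re_sub_le a ha σ τ).trans h1
    rw [← ofReal_norm, ENNReal.ofReal_le_ofReal_iff (by positivity)] at h2
    linarith [le_of_abs_le h2]
  have habs : ∀ τ, |f τ| ≤ ‖a‖ := fun τ => abs_trace_re_le_norm τ.2 a
  have hbdd : BddAbove (Set.range f) := ⟨‖a‖, by
    rintro _ ⟨τ, rfl⟩; exact (abs_le.1 (habs τ)).2⟩
  have hbdd' : BddBelow (Set.range f) := ⟨-‖a‖, by
    rintro _ ⟨τ, rfl⟩; exact (abs_le.1 (habs τ)).1⟩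
  have hosc : (⨆ σ, f σ) - 2 * r ≤ ⨅ τ, f τ :=
    le_ciInf fun τ => sub_le_iff_le_add.2 (ciSup_le fun σ => hf σ τ)
  refine ⟨((⨆ σ, f σ) + ⨅ τ, f τ) / 2,
    norm_quot_le_of_forall_trace hL.traciallyOrdered _ fun τ hτ => ?_⟩
  have h1 : f ⟨τ, hτ⟩ ≤ ⨆ σ, f σ := le_ciSup hbdd _
  have h2 : ⨅ τ, f τ ≤ f ⟨τ, hτ⟩ := ciInf_le hbdd' _
  rw [AddSubgroup.coe_sub, selfAdjoint.val_smul, selfAdjoint.val_one, map_sub, trace_smul_one hτ,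
    Complex.sub_re, Complex.ofReal_re]
  change |f ⟨τ, hτ⟩ - _| ≤ _
  rw [abs_le]
  constructor <;> linarith

end QuantumMetric
end CStarQMCS

/-! ### Existence of nuclei -/

open CStarQMCS in
theorem mainTheorem7 {A : Type*} [CStarAlgebra A] [PartialOrder A] [StarOrderedRing A]
    [TopologicalSpace.SeparableSpace A] (L : A → ℝ≥0∞) (hL : IsCStarQMCS L)
    (r : ℝ≥0) (hr : radius L ≤ (r : ℝ≥0∞)) :
    ∃ D : Set (selfAdjoint A), IsCompact D ∧
      quot A '' D = {x : CPQuotient A | quotSeminorm L x ≤ 1 ∧ ‖x‖ ≤ (r : ℝ)} ∧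
      D + Set.range (fun t : ℝ => t • (1 : selfAdjoint A)) + (cpNull A : Set (selfAdjoint A)) =
        {a : selfAdjoint A | L (a : A) ≤ 1} := by
  obtain ⟨D, hD, hDK⟩ := (cpNull A).exists_isCompact_image_mkQ_eq hL.isClosed_cpNull
    (hL.isCompact_quotSeminorm_le r)
  refine ⟨D, hD, hDK, Set.Subset.antisymm ?_ fun a ha => ?_⟩
  · rintro _ ⟨_, ⟨d, hd, _, ⟨t, rfl⟩, rfl⟩, n, hn, rfl⟩
    have hdK : quot A d ∈ {x : CPQuotient A | quotSeminorm L x ≤ 1 ∧ ‖x‖ ≤ (r : ℝ)} :=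
      hDK ▸ Set.mem_image_of_mem _ hd
    calc L ((d + t • 1 + n : selfAdjoint A) : A) = L ((d : A) + t • (1 : A) + (n : A)) := by simp
      _ ≤ L (d : A) + L (t • (1 : A)) + L (n : A) :=
        (hL.add_le _ _).trans (add_le_add_left (hL.add_le _ _) _)
      _ = quotSeminorm L (quot A d) := by
        rw [hL.apply_smul_one, hL.apply_cpNull hn, hL.quotSeminorm_quot, add_zero, add_zero]
      _ ≤ 1 := hdK.1
  · obtain ⟨t, ht⟩ := hL.exists_norm_quot_sub_le hr a ha
    have hmem : quot A (a - t • 1) ∈ quot A '' D := by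
      rw [hDK]
      refine ⟨?_, ht⟩
      rw [hL.quotSeminorm_quot]
      calc L ((a - t • 1 : selfAdjoint A) : A) = L ((a : A) + (-t) • (1 : A)) := by
            simp [sub_eq_add_neg]
        _ ≤ L (a : A) + L ((-t) • (1 : A)) := hL.add_le _ _
        _ ≤ 1 := by rw [hL.apply_smul_one, add_zero]; exact ha
    obtain ⟨d, hd, hda⟩ := hmem
    refine ⟨d + t • 1, ⟨d, hd, _, ⟨t, rfl⟩, rfl⟩, a - t • 1 - d,
      (Submodule.Quotient.eq _).1 hda.symm, ?_⟩
    simp only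
    abel
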